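/- **Protocol.** Let $N$ be a set of $n$ processes, $1\le\varphi\le t$, $n>3t$, and let $G\subseteq N$ with $|G|\ge n-t$ be the set of correct processes (the others are corrupt and send arbitrary messages, possibly different ones to different receivers). Let $D$ be a set of values with a default $\bot\in D$. Nodes are the repetition-free sequences of processes of length at most $t+1$; $\Sigma_r$ is the set of nodes of length $r$, $\sqsubseteq$ is the prefix order, $\bar\epsilon$ is the root, $\Sigma=\bigcup_r\Sigma_r$. Each $z\in G$ keeps partial maps $IT,RT:\Sigma\to D$, a set $F\subseteq N$ (initially, like the detections that concurrent invocations add to it in each round, containing no correct process) and a set of closed branches; initially $IT(\bar\epsilon)$ is its input and nothing else is defined or closed. Write $\nu\in RT$ if $RT(\nu)$ is defined, and $X[r]$ for the state of $X$ at the end of round $r$. In each round $r=1,\dots,\varphi+1$ a correct $z$ does the following; once all branches are closed it only goes on exchanging the sets $F$. *Send/receive.* $z$ sends its $F$ and, for each $\sigma\in\Sigma_{r-1}$ with $z\notin\sigma$ that is not closed, $\langle\sigma,z,IT(\sigma)\rangle$ to all. It adds to $F$ every process occurring in $t+1$ received sets. For every non-closed $\sigma x\in\Sigma_r$ it sets $IT(\sigma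 x)$ to $\bot$ if $x\in F$, to $d$ if $x\notin F$ sent $\langle\sigma,x,d\rangle$, and to $IT(\sigma)$ otherwise. *Supporters, voters* (for $\nu=\sigma w$ and $d\in D$; for $\nu=\bar\epsilon$ there is no $w$). $w$ supports every $v\notin\sigma$ if $IT(\nu)=d$; $v$ supports $v$ if $IT(\nu v)=d$; $u$ supports $v$ if $IT(\nu vu)=d$; $u$ supports $w$ if $IT(\nu u)=d$. $v$ is confirmed if it has $n-t$ supporters, or $v=w$ and $IT(\nu)=d$. $u\ne w$ is an unconfirmed voter if it supports $n-t$ processes, and a voter if it supports $n-t$ confirmed processes; $w$ is a voter if $IT(\nu)=d$. $\nu$ is leaning towards $d$ if it has $t+1$ unconfirmed voters. *Detection*, applied until no rule applies, with $RT=RT[r-1]$; adding $w$ to $F$ also resets the round-$r$ values $IT(\sigma w)$ to $\bot$. (Not Voter) If $\sigma w\in\Sigma_{r-1}$, $w\ne z$, no prefix of $\sigma w$ is in $RT$, and there are no $n-t-1$ processes $u$ with $IT(\sigma wu)=IT(\sigma w)$, add $w$ to $F$. (Not IT-to-RT) If $\sigma w\in\Sigma_{r-2}$, no prefix of $\sigma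 w$ is in $RT$, and $\sigma w$ does not have $n-t$ voters for any $d$, add $w$ to $F$. (Not Masking) If $\sigma w\in\Sigma_{r-3}$ is leaning towards $d$, $d'\ne d$, $IT(\sigma wuv)=d'$ for $t+1$ processes $v$, $|\sigma''|>|\sigma|$ and $IT(\sigma''wu)$ is defined and $\neq\bot$, set $IT(\sigma''wu):=\bot$; if at the end of the round no prefix of $\sigma''w$ is in $RT$, add $u$ to $F$. *Resolve*, applied (in any order) until no rule applies. Putting $RT(\nu):=d$, allowed only if $\nu\notin RT$, also gives the value $d$ to all descendants of $\nu$. (IT-to-RT) $\nu$ has $n-t$ voters for $d$: put $d$. (Last round) $|\nu|=\varphi+1$, $IT(\nu)=d$: put $d$. (Gradecast) $\nu$ has $t+1$ $RT$-voters for $d$: put $d$; here $v$ is $RT$-confirmed if $RT(\nu vu)=d$ for $t+1$ processes $u$, and $u\ne w$ is an $RT$-voter if there is a set $V$ of $n-t$ $RT$-confirmed processes with $RT(\nu vu)=d$ for $v\in V\setminus\{u\}$, and $RT(\nu u)=d$ if $u\in V$. (Relaxed) $\nu\neq\bar\epsilon$, all children of $\nu$ are in $RT$ and $n-t-1$ of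 them have value $d$: put $d$. (Special) $|\sigma u|\ge2$, all siblings of $\sigma u$ are in $RT$, and $t+2-|\sigma u|$ children of $\sigma u$ have value $\bot$ in $RT$: put $RT(\sigma u):=\bot$. (Special root) $t+1$ nodes of $\Sigma_1$ have value $\bot$ in $RT$: put $RT(\bar\epsilon):=\bot$. (Early, $r\le\varphi$) $\sigma\in\Sigma_{r-1}$ and there is $U\subseteq N\setminus\sigma$, $|U|=n-r$, with $IT(\sigma u)=IT(\sigma v)$ for all $u,v\in U\setminus F$: put $IT(\sigma)$ and close $\sigma$. (Strong, $r\le\varphi$) $\sigma\in\Sigma_{r-2}$ and there is $U\subseteq N\setminus\sigma$, $|U|=n-r+1$, with $IT(\sigma uv)=IT(\sigma vu)$ for all distinct $u,v\in U\setminus F$: put $IT(\sigma)$ and close $\sigma$. Moreover, if $r\le\varphi$, every node with a prefix in $RT[r-1]$ is closed. Closing a node closes its subtree. **Corrupt tree.** Fix an execution. A node $\nu$ is *fully corrupt* if no correct $p$ has a prefix of $\nu$ (including $\nu$) in $RT_p[|\nu|+2]$, where $RT_p[r]=RT_p[\varphi+1]$ for $r>\varphi+1$. A process $z$ *becomes fully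 corrupt at* $i$ if $i$ is the least length of a fully corrupt node ending in $z$. Let $\alpha_i$ be the number of processes that become fully corrupt at $i$ (so $\alpha_0=0$), $waste_i=\sum_{j\le i}\alpha_j-i$, and let $\mathcal{CT}$ be the set of fully corrupt nodes all of whose processes are corrupt. **Lemma.** There is an absolute constant $C$ such that the following holds for all $N,D,t,\varphi,G$ and all executions. Let $i_1<i_2$ with $\alpha_{i_1}>2$, $\alpha_{i_1-1}+\alpha_{i_1}<6$, $\alpha_{i_2}\in\{0,1\}$, $\alpha_i=1$ for all $i_1<i<i_2$, and $waste_{i_2+1}<6$. Then every $\sigma\in\Sigma_{i_1-1}\cap\mathcal{CT}$ is a prefix of at most $C(i_2-i_1)$ nodes of $\Sigma_{i_2+1}\cap\mathcal{CT}$, and of at most $C(i_2-i_1)^2$ nodes of $\mathcal{CT}$ of length at most $i_2+1$. -/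

import Mathlib

universe u v

namespace EIG

/-- Parameters of one invocation of the consensus protocol: at most `t` corrupt processes among
`card P > 3 t`, the parameter `φ` (the invocation runs for `φ + 1` rounds), the default decision
`bot`, and the set `G` of correct processes. -/
structure Setting (P : Type u) (D : Type v) [Fintype P] where
  t : ℕ
  φ : ℕ
  bot : D
  G : Finset P
  three_t_lt : 3 * t < Fintype.card P
  one_le_φ : 1 ≤ φ
  φ_le_t : φ ≤ t
  card_G : Fintype.card P ≤ G.card + t

variable {P : Type u} {D : Type v} [Fintype P]

/-- A node of the tree: a repetition-free sequence of at most `t + 1` processes.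
The node `σ q` is `σ ++ [q]`; the root is `[]`. -/
def Setting.IsNode (S : Setting P D) (ν : List P) : Prop :=
  ν.Nodup ∧ ν.length ≤ S.t + 1

/-- A (partial) labelling of the nodes by values; used for `IT` and `RT`. -/
abbrev Tree (P : Type u) (D : Type v) := List P → Option D

/-- Some prefix of `ν` (possibly `ν` itself) carries a value in `RT`. -/
def Resolved (RT : Tree P D) (ν : List P) : Prop :=
  ∃ σ, σ <+: ν ∧ RT σ ≠ none

/-! ### Definitions on the information tree `IT`

For a node `ν = σ w` the triple `(σ, w, d)` is written `ν d`. The root has no last process `w`. -/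

/-- `u` is a supporter of `v` on `(σ, w, d)`, where `ν = σ w`. -/
def Supporter (IT : Tree P D) (ν : List P) (d : D) (u v : P) : Prop :=
  -- `w` supports every `v` outside `σ`
  (ν.getLast? = some u ∧ IT ν = some d ∧ v ∉ ν.dropLast) ∨
  -- `v` supports itself
  (u = v ∧ IT (ν ++ [v]) = some d) ∨
  -- `u` echoes `v`
  IT (ν ++ [v, u]) = some d ∨
  -- `u` echoes `w` itself
  (ν.getLast? = some v ∧ IT (ν ++ [u]) = some d)

/-- `v` is confirmed on `(σ, w, d)`. -/
def Confirmed (S : Setting P D) (IT : Tree P D) (ν : List P) (d : D) (v : P) : Prop :=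
  (ν.getLast? = some v ∧ IT ν = some d) ∨
  ∃ U : Finset P, U.card = Fintype.card P - S.t ∧ ∀ u ∈ U, Supporter IT ν d u v

/-- `u` is a voter of `(σ, w, d)`. -/
def Voter (S : Setting P D) (IT : Tree P D) (ν : List P) (d : D) (u : P) : Prop :=
  (ν.getLast? = some u ∧ IT ν = some d) ∨
  (ν.getLast? ≠ some u ∧ ∃ V : Finset P, V.card = Fintype.card P - S.t ∧
    ∀ v ∈ V, Supporter IT ν d u v ∧ Confirmed S IT ν d v)

/-- `n - t` processes are voters of `(σ, w, d)`. -/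
def HasVoters (S : Setting P D) (IT : Tree P D) (ν : List P) (d : D) : Prop :=
  ∃ U : Finset P, U.card = Fintype.card P - S.t ∧ ∀ u ∈ U, Voter S IT ν d u

/-- `u` is an unconfirmed voter of `(σ, w, d)`. -/
def UnconfirmedVoter (S : Setting P D) (IT : Tree P D) (ν : List P) (d : D) (u : P) : Prop :=
  ν.getLast? ≠ some u ∧ ∃ V : Finset P, V.card = Fintype.card P - S.t ∧
    ∀ v ∈ V, Supporter IT ν d u v

/-- `ν` is leaning towards `d`. -/
def LeaningTowards (S : Setting P D) (IT : Tree P D) (ν : List P) (d : D) : Prop :=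
  ∃ U : Finset P, U.card = S.t + 1 ∧ ∀ u ∈ U, UnconfirmedVoter S IT ν d u

/-! ### Definitions on the resolve tree `RT` -/

/-- `v` is `RT`-confirmed on `(σ, w, d)`. -/
def RTConfirmed (S : Setting P D) (RT : Tree P D) (ν : List P) (d : D) (v : P) : Prop :=
  ∃ U : Finset P, U.card = S.t + 1 ∧ ∀ u ∈ U, RT (ν ++ [v, u]) = some d

/-- `u` is an `RT`-voter of `(σ, w, d)`. -/
def RTVoter (S : Setting P D) (RT : Tree P D) (ν : List P) (d : D) (u : P) : Prop :=
  ν.getLast? ≠ some u ∧ ∃ V : Finset P, V.card = Fintype.card P - S.t ∧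
    ∀ v ∈ V, RTConfirmed S RT ν d v ∧
      (v ≠ u → RT (ν ++ [v, u]) = some d) ∧ (v = u → RT (ν ++ [u]) = some d)

open Classical in
/-- Put the value `d` into `ν` and color all descendants of `ν` with `d`. -/
noncomputable def put (S : Setting P D) (RT : Tree P D) (ν : List P) (d : D) : Tree P D :=
  fun τ => if S.IsNode τ ∧ ν <+: τ then some d else RT τ

/-- Condition of the early rule at the end of round `r`: all children of `σ` but at most one
agree, ignoring the processes detected as faulty. -/
def EarlyCond (S : Setting P D) (r : ℕ) (F : Set P) (IT : Tree P D) (σ : List P) : Prop :=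
  r ≤ S.φ ∧ S.IsNode σ ∧ σ.length + 1 = r ∧
  ∃ U : Finset P, (∀ u ∈ U, u ∉ σ) ∧ U.card = Fintype.card P - r ∧
    ∀ u ∈ U, ∀ v ∈ U, u ∉ F → v ∉ F → IT (σ ++ [u]) = IT (σ ++ [v])

/-- Condition of the strong rule at the end of round `r`. -/
def StrongCond (S : Setting P D) (r : ℕ) (F : Set P) (IT : Tree P D) (σ : List P) : Prop :=
  r ≤ S.φ ∧ S.IsNode σ ∧ σ.length + 2 = r ∧
  ∃ U : Finset P, (∀ u ∈ U, u ∉ σ) ∧ U.card = Fintype.card P - r + 1 ∧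
    ∀ u ∈ U, ∀ v ∈ U, u ∉ F → v ∉ F → u ≠ v → IT (σ ++ [u, v]) = IT (σ ++ [v, u])

/-- `Resolves S r F IT RT ν d`: at the end of round `r` one of the resolve rules allows to put
the value `d` into `ν`. -/
inductive Resolves (S : Setting P D) (r : ℕ) (F : Set P) (IT RT : Tree P D) :
    List P → D → Prop
  | itToRt (ν : List P) (d : D) (h : HasVoters S IT ν d) : Resolves S r F IT RT ν d
  | lastRound (ν : List P) (d : D) (hl : ν.length = S.φ + 1) (h : IT ν = some d) :
      Resolves S r F IT RT ν d
  | gradecast (ν : List P) (d : D) (U : Finset P) (hU : U.card = S.t + 1)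
      (h : ∀ u ∈ U, RTVoter S RT ν d u) : Resolves S r F IT RT ν d
  | relaxed (ν : List P) (d : D) (hν : ν ≠ [])
      (hall : ∀ v, S.IsNode (ν ++ [v]) → RT (ν ++ [v]) ≠ none)
      (V : Finset P) (hV : V.card = Fintype.card P - S.t - 1)
      (h : ∀ v ∈ V, RT (ν ++ [v]) = some d) : Resolves S r F IT RT ν d
  | special (σ : List P) (u : P) (hσ : 2 ≤ (σ ++ [u]).length)
      (V : Finset P) (hV : V.card = S.t + 2 - (σ ++ [u]).length)
      (h : ∀ v ∈ V, RT (σ ++ [u, v]) = some S.bot)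
      (hsib : ∀ u', u' ≠ u → S.IsNode (σ ++ [u']) → RT (σ ++ [u']) ≠ none) :
      Resolves S r F IT RT (σ ++ [u]) S.bot
  | specialRoot (U : Finset P) (hU : U.card = S.t + 1)
      (h : ∀ u ∈ U, RT [u] = some S.bot) : Resolves S r F IT RT [] S.bot
  | early (σ : List P) (d : D) (h : EarlyCond S r F IT σ) (hd : IT σ = some d) :
      Resolves S r F IT RT σ d
  | strong (σ : List P) (d : D) (h : StrongCond S r F IT σ) (hd : IT σ = some d) :
      Resolves S r F IT RT σ d

/-- One application of a resolve rule to a node that has no value yet. -/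
def ResolveStep (S : Setting P D) (r : ℕ) (F : Set P) (IT : Tree P D) (RT RT' : Tree P D) : Prop :=
  ∃ ν d, S.IsNode ν ∧ RT ν = none ∧ Resolves S r F IT RT ν d ∧ RT' = put S RT ν d

/-! ### Fault detection and masking -/

/-- Data changed by fault detection in a round: the set of detected processes, the information
tree, and the nodes masked by the rule "Not Masking" in this round. -/
structure Detection (P : Type u) (D : Type v) where
  F : Set P
  IT : Tree P D
  masked : Set (List P)

open Classical in
/-- Add `w` to `F` and mask the messages of `w` of the current round `r`. -/
noncomputable def Detection.suspect (S : Setting P D) (r : ℕ) (s : Detection P D) (w : P) :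
    Detection P D where
  F := insert w s.F
  IT := fun ν =>
    if ν.length = r ∧ ν.getLast? = some w ∧ s.IT ν ≠ none then some S.bot else s.IT ν
  masked := s.masked

open Classical in
/-- Mask the single node `ν`. -/
noncomputable def Detection.mask (S : Setting P D) (s : Detection P D) (ν : List P) :
    Detection P D where
  F := s.F
  IT := fun τ => if τ = ν then some S.bot else s.IT τ
  masked := insert ν s.masked

/-- One application of a fault detection rule at process `z` at the end of round `r`; `RT` is the
resolve tree at the end of the previous round. -/
inductive DetectStep (S : Setting P D) (z : P) (r : ℕ) (RT : Tree P D) (s : Detection P D) :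
    Detection P D → Prop
  | notVoter (σ : List P) (w : P) (hw : w ∉ s.F) (hν : S.IsNode (σ ++ [w]))
      (hr : (σ ++ [w]).length + 1 = r) (hz : w ≠ z) (hRT : ¬ Resolved RT (σ ++ [w]))
      (h : ¬ ∃ U : Finset P, U.card = Fintype.card P - S.t - 1 ∧
        ∀ u ∈ U, s.IT (σ ++ [w, u]) = s.IT (σ ++ [w])) :
      DetectStep S z r RT s (s.suspect S r w)
  | notItToRt (σ : List P) (w : P) (hw : w ∉ s.F) (hν : S.IsNode (σ ++ [w]))
      (hr : (σ ++ [w]).length + 2 = r) (hRT : ¬ Resolved RT (σ ++ [w]))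
      (h : ¬ ∃ d, HasVoters S s.IT (σ ++ [w]) d) :
      DetectStep S z r RT s (s.suspect S r w)
  | notMasking (σ σ'' : List P) (w u : P) (d d' d'' : D) (hν : S.IsNode (σ ++ [w]))
      (hr : (σ ++ [w]).length + 3 = r) (hlean : LeaningTowards S s.IT (σ ++ [w]) d)
      (hd : d' ≠ d) (V : Finset P) (hV : V.card = S.t + 1)
      (h : ∀ v ∈ V, s.IT (σ ++ [w, u, v]) = some d')
      (hlen : σ.length < σ''.length) (hd'' : d'' ≠ S.bot)
      (h'' : s.IT (σ'' ++ [w, u]) = some d'') :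
      DetectStep S z r RT s (s.mask S (σ'' ++ [w, u]))

/-- `b` is reached from `a` by applying rules until none is applicable. -/
def Exhausts {α : Type*} (R : α → α → Prop) (a b : α) : Prop :=
  Relation.ReflTransGen R a b ∧ ∀ c, ¬ R b c

/-! ### Executions -/

/-- Local state of a process at the end of a round. -/
structure LocalState (P : Type u) (D : Type v) where
  IT : Tree P D
  RT : Tree P D
  F : Set P
  closed : Set (List P)

open Classical in
/-- The value that a correct process `z` in state `s` sends in round `r` for the node `σ`. -/
noncomputable def sent (S : Setting P D) (r : ℕ) (z : P) (s : LocalState P D) (σ : List P) :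
    Option D :=
  if S.IsNode σ ∧ σ.length + 1 = r ∧ z ∉ σ ∧ σ ∉ s.closed then s.IT σ else none

open Classical in
/-- The receive rule in round `r`, where `m x σ` is the value received from `x` for `σ`. -/
noncomputable def receive (S : Setting P D) (r : ℕ) (F : Set P) (m : P → List P → Option D)
    (s : LocalState P D) : Tree P D := fun ν =>
  if S.IsNode ν ∧ ν.length = r ∧ ν ∉ s.closed then
    match ν.getLast? with
    | none => s.IT ν
    | some x => if x ∈ F then some S.bot else (m x ν.dropLast).or (s.IT ν.dropLast)
  else s.IT ν

/-- The faulty set after the exchange of the faulty sets in a round: `l x` is the set received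
from `x`, and `ext` are the detections made by concurrently running invocations. -/
def gossip (S : Setting P D) (F ext : Set P) (l : P → Set P) : Set P :=
  F ∪ ext ∪ {b | ∃ Q : Finset P, Q.card = S.t + 1 ∧ ∀ x ∈ Q, b ∈ l x}

/-- The branches closed at the end of round `r`; `RT` is the resolve tree at the end of round
`r - 1`. Closing a node closes its whole subtree. -/
def closeAfter (S : Setting P D) (r : ℕ) (RT : Tree P D) (F : Set P) (IT : Tree P D)
    (closed : Set (List P)) : Set (List P) :=
  closed ∪ {ν | r ≤ S.φ ∧ Resolved RT ν} ∪
    {ν | ∃ σ, σ <+: ν ∧ (EarlyCond S r F IT σ ∨ StrongCond S r F IT σ)}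

/-- All branches are closed at the end of round `r`. -/
def Stopped (S : Setting P D) (r : ℕ) (s : LocalState P D) : Prop :=
  ∀ ν, S.IsNode ν → ν.length = r → ν ∈ s.closed

/-- A correct process `z` passes from state `s` (end of round `r - 1`) to `s'` (end of round `r`),
having received the values `m`, the faulty sets `l` and the external detections `ext`. -/
def RoundStep (S : Setting P D) (z : P) (r : ℕ) (m : P → List P → Option D) (l : P → Set P)
    (ext : Set P) (s s' : LocalState P D) : Prop :=
  (Stopped S (r - 1) s ∧
    s' = { s with F := gossip S s.F ext l }) ∨
  (¬ Stopped S (r - 1) s ∧ ∃ det : Detection P D,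
    Exhausts (DetectStep S z r s.RT)
      ⟨gossip S s.F ext l, receive S r (gossip S s.F ext l) m s, ∅⟩ det ∧
    Exhausts (ResolveStep S r det.F det.IT) s.RT s'.RT ∧
    s'.IT = det.IT ∧
    s'.F = det.F ∪ {u | ∃ σ, σ ++ [u] ∈ det.masked ∧ ¬ Resolved s'.RT σ} ∧
    s'.closed = closeAfter S r s.RT det.F det.IT s.closed)

/-- An execution of the protocol. The messages of corrupt processes are arbitrary; they may differ
from receiver to receiver. -/
structure Execution (S : Setting P D) where
  /-- initial values -/
  input : P → D
  /-- `state r p` is the state of `p` at the end of round `r` (for correct `p`) -/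
  state : ℕ → P → LocalState P D
  /-- `msg r q p σ = some d` if `q` sends `⟨σ, q, d⟩` to `p` in round `r` -/
  msg : ℕ → P → P → List P → Option D
  /-- `list r q p` is the faulty set that `q` sends to `p` in round `r` -/
  list : ℕ → P → P → Set P
  /-- `ext r p`: processes that `p` detects in round `r` through concurrent invocations -/
  ext : ℕ → P → Set P
  ext_corrupt : ∀ r, ∀ p ∈ S.G, ∀ q ∈ S.G, q ∉ ext r p
  init_IT : ∀ p ∈ S.G, ∀ ν, ν ≠ [] → (state 0 p).IT ν = none
  init_root : ∀ p ∈ S.G, (state 0 p).IT [] = some (input p)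
  init_RT : ∀ p ∈ S.G, ∀ ν, (state 0 p).RT ν = none
  init_closed : ∀ p ∈ S.G, (state 0 p).closed = ∅
  init_F : ∀ p ∈ S.G, ∀ q ∈ S.G, q ∉ (state 0 p).F
  msg_correct : ∀ r, ∀ q ∈ S.G, ∀ p σ, msg (r + 1) q p σ = sent S (r + 1) q (state r q) σ
  list_correct : ∀ r, ∀ q ∈ S.G, ∀ p, list (r + 1) q p = (state r q).F
  step : ∀ r ≤ S.φ, ∀ p ∈ S.G,
    RoundStep S p (r + 1) (fun q => msg (r + 1) q p) (fun q => list (r + 1) q p)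
      (ext (r + 1) p) (state r p) (state (r + 1) p)

namespace Execution

variable {S : Setting P D} (E : Execution S)

/-- `RT_p[r]`, the resolve tree of `p` at the end of round `r`. It no longer changes after the
last round `φ + 1`. -/
def RTAt (p : P) (r : ℕ) : Tree P D := (E.state (min r (S.φ + 1)) p).RT

/-- The node `ν` is fully corrupt: at the end of round `|ν| + 2` no correct process has resolved
`ν` or one of its prefixes. -/
def FullyCorrupt (ν : List P) : Prop :=
  S.IsNode ν ∧ ∀ p ∈ S.G, ¬ Resolved (E.RTAt p (ν.length + 2)) ν

/-- The process `z` becomes fully corrupt at `i`. -/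
def BecomesFullyCorruptAt (z : P) (i : ℕ) : Prop :=
  (∃ σ : List P, (σ ++ [z]).length = i ∧ E.FullyCorrupt (σ ++ [z])) ∧
  ∀ σ : List P, (σ ++ [z]).length < i → ¬ E.FullyCorrupt (σ ++ [z])

/-- `α_i`, the number of processes that become fully corrupt at `i` (so `α_0 = 0`). -/
noncomputable def α (i : ℕ) : ℕ := {z | E.BecomesFullyCorruptAt z i}.ncard

/-- `waste_i = (∑_{j ≤ i} α_j) - i`. -/
noncomputable def waste (i : ℕ) : ℤ := (∑ j ∈ Finset.range (i + 1), (E.α j : ℤ)) - i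

/-- The corrupt tree: all fully corrupt nodes made of corrupt processes. -/
def CT : Set (List P) := {ν | E.FullyCorrupt ν ∧ ∀ z ∈ ν, z ∉ S.G}

end Execution

end EIG

namespace EIG

/-! ### Propagation of values in `RT`: a node gets none from strictly below the current level. -/

variable {P : Type u} {D : Type v}

/-! The heart is `Execution.length_le_of_fullyCorrupt`. If `σz` of length `i` is fully corrupt, no
correct process sees `n - t` voters for it by round `i + 2`, so each of them detects `z` in that
round (`Execution.masked_of_fullyCorrupt`). A longer node `τz`, of length at least `i + 2`, is then
masked to `⊥` by all correct processes; they echo `⊥` on its correct descendants, and `τz` is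
resolved too early to be fully corrupt. Hence the process at position `j` of a node of the corrupt
tree became fully corrupt at `j` or at `j - 1` (`Execution.layered_CT`).

The rest is counting. Level `i₁ - 1` contains only `σ`, and two steps multiply by at most `5` and
`6`. Where each `α` is `1`, a node either ends in the new process of its level or lags one behind. A
lagging node comes from a lagging node, since repetition is forbidden, so each level adds only a
constant (`Layered.ncard_extensions_le`). The bound on the waste controls the last level, and
summing over the levels gives the quadratic bound. -/

theorem Resolved.mono {RT : Tree P D} {ν τ : List P} (h : Resolved RT ν) (hp : ν <+: τ) :
    Resolved RT τ := by
  obtain ⟨σ, hσ, h⟩ := h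
  exact ⟨σ, hσ.trans hp, h⟩

/-- At every node with a value, the value is due to a prefix of length at most `r`. -/
def ResolvedUpTo (r : ℕ) (RT : Tree P D) : Prop :=
  ∀ ν, RT ν ≠ none → ∃ σ, σ <+: ν ∧ σ.length ≤ r ∧ RT σ ≠ none

theorem ResolvedUpTo.prefix_of_append {r : ℕ} {RT : Tree P D} (h : ResolvedUpTo r RT)
    {ν τ : List P} (hr : r ≤ ν.length) (hRT : RT (ν ++ τ) ≠ none) :
    ∃ σ, σ <+: ν ∧ σ.length ≤ r ∧ RT σ ≠ none := by
  obtain ⟨σ, hσ, hl, hn⟩ := h _ hRT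
  exact ⟨σ, List.prefix_of_prefix_length_le hσ (List.prefix_append _ _) (hl.trans hr), hl, hn⟩

variable [Fintype P]

theorem Exhausts.invariant {α : Type*} {R : α → α → Prop} {a b : α} (h : Exhausts R a b)
    (p : α → Prop) (ha : p a) (hstep : ∀ x y, R x y → p x → p y) : p b := by
  obtain ⟨h, -⟩ := h
  induction h with
  | refl => exact ha
  | tail _ hxy ih => exact hstep _ _ hxy ih

theorem Setting.IsNode.of_prefix {S : Setting P D} {ν τ : List P} (h : S.IsNode τ) (hp : ν <+: τ) :
    S.IsNode ν :=
  ⟨h.1.sublist hp.sublist, hp.length_le.trans h.2⟩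

theorem put_ne_none {S : Setting P D} {RT : Tree P D} {ν τ : List P} {d : D} (h : RT τ ≠ none) :
    put S RT ν d τ ≠ none := by
  unfold put
  split_ifs <;> simp_all

theorem ResolveStep.ne_none {S : Setting P D} {r : ℕ} {F : Set P} {IT RT RT' : Tree P D}
    (h : ResolveStep S r F IT RT RT') {τ : List P} (hτ : RT τ ≠ none) : RT' τ ≠ none := by
  obtain ⟨ν, d, -, -, -, rfl⟩ := h
  exact put_ne_none hτ

/-- Once no resolve rule applies, every node on which a rule allows a value has a value. -/
theorem Resolves.ne_none_of_exhausts {S : Setting P D} {r : ℕ} {F : Set P} {IT RT RT' : Tree P D}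
    (h : Exhausts (ResolveStep S r F IT) RT RT') {ν : List P} {d : D} (hν : S.IsNode ν)
    (hr : Resolves S r F IT RT' ν d) : RT' ν ≠ none :=
  fun hn => h.2 _ ⟨ν, d, hν, hn, hr, rfl⟩

theorem Setting.t_lt_card (S : Setting P D) : S.t + 2 ≤ Fintype.card P - S.t := by
  have := S.three_t_lt; have := S.one_le_φ; have := S.φ_le_t; omega

/-- Every way of supporting other than through the value of `ν` itself needs a value strictly below
`ν`. -/
theorem HasVoters.eq_some {S : Setting P D} {IT : Tree P D} {ν : List P} {d : D}
    (hIT : ∀ τ : List P, ν.length < τ.length → IT τ = none) (h : HasVoters S IT ν d) :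
    IT ν = some d := by
  have ht := S.t_lt_card
  obtain ⟨U, hU, h⟩ := h
  obtain ⟨u, hu⟩ : U.Nonempty := Finset.card_pos.1 (by omega)
  rcases h u hu with h | ⟨-, V, hV, h⟩
  · exact h.2
  · obtain ⟨v, hv⟩ : V.Nonempty := Finset.card_pos.1 (by omega)
    rcases (h v hv).1 with h | h | h | h
    · exact h.2.1
    · rw [hIT _ (by simp)] at h; simp at h
    · rw [hIT _ (by simp)] at h; simp at h
    · rw [hIT _ (by simp)] at h; simp at h

/-- A rule that applies at the end of round `r` to a node of length at least `r` puts the value of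
`IT`, unless the node is already settled by a prefix. -/
theorem Resolves.eq_some_or_prefix {S : Setting P D} {r : ℕ} {F : Set P} {IT RT : Tree P D}
    (hIT : ∀ τ : List P, r < τ.length → IT τ = none) (hRT : ResolvedUpTo r RT)
    {ν : List P} {d : D} (hν : S.IsNode ν) (hr : r ≤ ν.length) (h : Resolves S r F IT RT ν d) :
    IT ν = some d ∨ ∃ σ, σ <+: ν ∧ σ.length ≤ r ∧ RT σ ≠ none := by
  have ht := S.t_lt_card
  cases h with
  | itToRt _ _ h => exact .inl (h.eq_some fun τ hτ => hIT τ (hr.trans_lt hτ))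
  | lastRound _ _ hl h => exact .inl h
  | gradecast _ _ U hU h =>
    obtain ⟨u, hu⟩ : U.Nonempty := Finset.card_pos.1 (by omega)
    obtain ⟨-, V, hV, h⟩ := h u hu
    obtain ⟨v, hv⟩ : V.Nonempty := Finset.card_pos.1 (by omega)
    obtain ⟨W, hW, h⟩ := (h v hv).1
    obtain ⟨w, hw⟩ : W.Nonempty := Finset.card_pos.1 (by omega)
    exact .inr (hRT.prefix_of_append hr (by rw [h w hw]; simp))
  | relaxed _ _ hν hall V hV h =>
    obtain ⟨v, hv⟩ : V.Nonempty := Finset.card_pos.1 (by omega)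
    exact .inr (hRT.prefix_of_append hr (by rw [h v hv]; simp))
  | special σ u hσ V hV h hsib =>
    have := hν.2
    obtain ⟨v, hv⟩ : V.Nonempty := Finset.card_pos.1 (by omega)
    refine .inr (hRT.prefix_of_append (τ := [v]) hr ?_)
    have := h v hv
    simp_all
  | specialRoot U hU h =>
    obtain ⟨v, hv⟩ : U.Nonempty := Finset.card_pos.1 (by omega)
    exact .inr (hRT.prefix_of_append (τ := [v]) hr (by simp [h v hv]))
  | early _ _ h hd => have := h.2.2.1; omega
  | strong _ _ h hd => have := h.2.2.1; omega

/-- A rule acting below level `r` needs either a value of `IT`, which is missing there, or valued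
descendants in `RT`, whose values already come from a short prefix. -/
theorem ResolvedUpTo.resolveStep {S : Setting P D} {r : ℕ} {F : Set P} {IT RT RT' : Tree P D}
    (hIT : ∀ τ : List P, r < τ.length → IT τ = none) (hRT : ResolvedUpTo r RT)
    (h : ResolveStep S r F IT RT RT') : ResolvedUpTo r RT' := by
  have hne := fun τ => h.ne_none (τ := τ)
  obtain ⟨ν, d, hν, hnone, hres, rfl⟩ := h
  intro τ hτ
  by_cases hp : S.IsNode τ ∧ ν <+: τ
  · by_cases hr : ν.length ≤ r
    · exact ⟨ν, hp.2, hr, by simp [put, hν]⟩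
    · rcases hres.eq_some_or_prefix hIT hRT hν (by omega) with h | ⟨σ, hσ, hl, hn⟩
      · rw [hIT _ (by omega)] at h; simp at h
      · exact ⟨σ, hσ.trans hp.2, hl, hne _ hn⟩
  · rw [put, if_neg hp] at hτ
    obtain ⟨σ, hσ, hl, hn⟩ := hRT _ hτ
    exact ⟨σ, hσ, hl, hne _ hn⟩

theorem resolvedUpTo_of_exhausts {S : Setting P D} {r : ℕ} {F : Set P} {IT RT RT' : Tree P D}
    (hIT : ∀ τ : List P, r < τ.length → IT τ = none) (hRT : ResolvedUpTo r RT)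
    (h : Exhausts (ResolveStep S r F IT) RT RT') : ResolvedUpTo r RT' :=
  h.invariant _ hRT fun _ _ hxy hx => hx.resolveStep hIT hxy

theorem ne_none_of_exhausts {S : Setting P D} {r : ℕ} {F : Set P} {IT RT RT' : Tree P D}
    (h : Exhausts (ResolveStep S r F IT) RT RT') {τ : List P} (hτ : RT τ ≠ none) : RT' τ ≠ none :=
  h.invariant (fun T => T τ ≠ none) hτ fun _ _ hxy hx => hxy.ne_none hx

/-- In the last round a leaf receives its value from `IT` or from a proper prefix. -/
theorem leaf_eq_some {S : Setting P D} {F : Set P} {IT RT RT' : Tree P D}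
    (hIT : ∀ τ : List P, S.φ + 1 < τ.length → IT τ = none) (hRT : ResolvedUpTo S.φ RT)
    (h : Exhausts (ResolveStep S (S.φ + 1) F IT) RT RT') {ν : List P}
    (hl : ν.length = S.φ + 1) {d : D} (hd : RT' ν = some d) :
    IT ν = some d ∨ ∃ σ, σ <+: ν ∧ σ.length ≤ S.φ ∧ RT' σ ≠ none := by
  revert d
  refine (h.invariant (fun T => ResolvedUpTo (S.φ + 1) T ∧ ∀ {d}, T ν = some d →
    IT ν = some d ∨ ∃ σ, σ <+: ν ∧ σ.length ≤ S.φ ∧ T σ ≠ none) ⟨?_, ?_⟩ ?_).2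
  · intro τ hτ
    obtain ⟨σ, h1, h2, h3⟩ := hRT τ hτ
    exact ⟨σ, h1, by omega, h3⟩
  · intro d hd
    exact .inr (hRT ν (by simp [hd]))
  · rintro T T' hst ⟨hup, hx⟩
    refine ⟨hup.resolveStep hIT hst, ?_⟩
    intro d hd
    have hne := fun τ => hst.ne_none (τ := τ)
    obtain ⟨ν', d', hν, hnone, hres, rfl⟩ := hst
    by_cases hp : S.IsNode ν ∧ ν' <+: ν
    · by_cases hlt : ν'.length ≤ S.φ
      · exact .inr ⟨ν', hp.2, hlt, by simp [put, hν]⟩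
      · obtain rfl : ν' = ν := hp.2.eq_of_length (by have := hp.2.length_le; omega)
        rw [put, if_pos hp] at hd
        obtain rfl := Option.some.inj hd
        rcases hres.eq_some_or_prefix hIT hup hν (by omega) with h | ⟨σ, hσ, hl', hn⟩
        · exact .inl h
        · refine .inr ⟨σ, hσ, ?_, hne _ hn⟩
          -- A prefix of length `φ + 1` would be the leaf itself, which had no value before this
          -- step.
          by_contra hc
          obtain rfl : σ = ν' := hσ.eq_of_length (by omega)
          exact hn hnone
    · rw [put, if_neg hp] at hd
      rcases hx hd with h | ⟨σ, h1, h2, h3⟩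
      · exact .inl h
      · exact .inr ⟨σ, h1, h2, hne _ h3⟩

/-! ### Fault detection -/

/-- Fault detection only adds processes to `F` and only replaces values by `⊥`. -/
structure Detection.Le (S : Setting P D) (s s' : Detection P D) : Prop where
  F_subset : s.F ⊆ s'.F
  eq_bot : ∀ ν, s.IT ν = some S.bot → s'.IT ν = some S.bot
  none_iff : ∀ ν, s'.IT ν = none ↔ s.IT ν = none

/-- The round-`r` values of the processes in `F` are `⊥` or undefined. -/
def Detection.Masks (S : Setting P D) (r : ℕ) (s : Detection P D) : Prop :=
  ∀ w ∈ s.F, ∀ ν : List P, ν.length = r → ν.getLast? = some w → s.IT ν ≠ none →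
    s.IT ν = some S.bot

theorem Detection.le_suspect (S : Setting P D) (r : ℕ) (s : Detection P D) (w : P) :
    s.Le S (s.suspect S r w) where
  F_subset := Set.subset_insert _ _
  eq_bot ν h := by simp [suspect, h]
  none_iff ν := by
    simp only [suspect]
    split_ifs with h
    · simp [h.2.2]
    · rfl

theorem Detection.le_mask (S : Setting P D) (s : Detection P D) {ν : List P} (h : s.IT ν ≠ none) :
    s.Le S (s.mask S ν) where
  F_subset := subset_rfl
  eq_bot ν h := by simp [mask, h]
  none_iff τ := by
    simp only [mask]
    split_ifs with h'
    · subst h'; simp [h]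
    · rfl

theorem DetectStep.le {S : Setting P D} {z : P} {r : ℕ} {RT : Tree P D} {s s' : Detection P D}
    (h : DetectStep S z r RT s s') : s.Le S s' := by
  cases h with
  | notVoter => exact s.le_suspect ..
  | notItToRt => exact s.le_suspect ..
  | notMasking _ _ _ _ _ _ _ _ _ _ _ _ _ _ _ _ h => exact s.le_mask S (by simp [h])

/-- A newly suspected process has its current values reset, and no rule ever turns `⊥` into another
value. -/
theorem Detection.Masks.detectStep {S : Setting P D} {z : P} {r : ℕ} {RT : Tree P D}
    {s s' : Detection P D} (hm : s.Masks S r) (h : DetectStep S z r RT s s') : s'.Masks S r := by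
  have hsus : ∀ w, (s.suspect S r w).Masks S r := by
    intro w w' hw' ν hl hlast hne
    have hne' := mt ((s.le_suspect S r w).none_iff ν).2 hne
    rcases hw' with rfl | hw'
    · simp [suspect, hl, hlast, hne']
    · exact (s.le_suspect S r w).eq_bot _ (hm w' hw' ν hl hlast hne')
  have hle := h.le
  cases h with
  | notVoter => exact hsus _
  | notItToRt => exact hsus _
  | notMasking =>
    intro w' hw' ν hl hlast hne
    exact hle.eq_bot _ (hm w' hw' ν hl hlast (mt (hle.none_iff ν).2 hne))

theorem detection_le_of_exhausts {S : Setting P D} {z : P} {r : ℕ} {RT : Tree P D}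
    {s s' : Detection P D} (h : Exhausts (DetectStep S z r RT) s s') : s.Le S s' :=
  h.invariant _ ⟨subset_rfl, fun _ => id, fun _ => Iff.rfl⟩ fun _ _ hxy hx =>
    ⟨hx.1.trans hxy.le.1, fun ν hν => hxy.le.2 ν (hx.2 ν hν),
      fun ν => (hxy.le.3 ν).trans (hx.3 ν)⟩

theorem masks_receive {S : Setting P D} {r : ℕ} {F : Set P} {m : P → List P → Option D}
    {s : LocalState P D} (hs : ∀ ν : List P, ν.length = r → s.IT ν = none)
    (M : Set (List P)) : Detection.Masks S r ⟨F, receive S r F m s, M⟩ := by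
  intro w hw ν hl hlast hne
  simp only [receive] at hne ⊢
  split_ifs at hne ⊢ with h
  · rw [hlast]
    have : w ∈ F := hw
    simp [this]
  · exact absurd (hs ν hl) hne

/-! ### Invariants of a correct process -/

/-- Invariants of a correct process at the end of round `r`. -/
structure LocalState.Inv (S : Setting P D) (r : ℕ) (s : LocalState P D) : Prop where
  resolvedUpTo : ResolvedUpTo r s.RT
  IT_eq_none : ∀ ν : List P, r < ν.length → s.IT ν = none
  IT_ne_none : ∀ ν, S.IsNode ν → ν.length ≤ r → ν ∉ s.closed → s.IT ν ≠ none
  closed_mono : ∀ ν ∈ s.closed, ∀ τ, ν <+: τ → τ ∈ s.closed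
  resolved_of_closed : ∀ ν ∈ s.closed, ∃ σ, σ <+: ν ∧ σ.length + 1 ≤ r ∧ s.RT σ ≠ none

/-- An open node still has a value in `IT`, so the early or strong rule is applicable and exhaustion
forces a value in `RT`. A closed node is covered by the invariant. -/
theorem LocalState.Inv.closed_of_early {S : Setting P D} {r : ℕ} {s s' : LocalState P D}
    {F : Set P} {IT : Tree P D} (hs : s.Inv S r)
    (hex : Exhausts (ResolveStep S (r + 1) F IT) s.RT s'.RT)
    (hIT : ∀ ν : List P, ν.length ≤ r → s.IT ν ≠ none → IT ν ≠ none) {σ : List P}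
    (h : EarlyCond S (r + 1) F IT σ ∨ StrongCond S (r + 1) F IT σ) :
    ∃ τ, τ <+: σ ∧ τ.length + 1 ≤ r + 1 ∧ s'.RT τ ≠ none := by
  obtain ⟨hν, hl⟩ : S.IsNode σ ∧ σ.length ≤ r := by
    rcases h with h | h <;> exact ⟨h.2.1, by have := h.2.2.1; omega⟩
  by_cases hc : σ ∈ s.closed
  · obtain ⟨τ, h1, h2, h3⟩ := hs.resolved_of_closed σ hc
    exact ⟨τ, h1, by omega, ne_none_of_exhausts hex h3⟩
  · obtain ⟨d, hd⟩ := Option.ne_none_iff_exists'.1 (hIT σ hl (hs.IT_ne_none σ hν hl hc))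
    refine ⟨σ, List.prefix_rfl, by omega, ?_⟩
    rcases h with h | h
    · exact Resolves.ne_none_of_exhausts hex hν (.early σ d h hd)
    · exact Resolves.ne_none_of_exhausts hex hν (.strong σ d h hd)

theorem LocalState.Inv.roundStep {S : Setting P D} {z : P} {r : ℕ} {m : P → List P → Option D}
    {l : P → Set P} {ext : Set P} {s s' : LocalState P D} (hs : s.Inv S r)
    (h : RoundStep S z (r + 1) m l ext s s') : s'.Inv S (r + 1) := by
  have hdrop : ∀ ν : List P, ν.length = r + 1 → ν.dropLast <+: ν ∧ ν.dropLast.length = r :=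
    fun ν hν => ⟨List.dropLast_prefix ν, by simp [hν]⟩
  rcases h with ⟨hst, rfl⟩ | ⟨-, det, hdet, hres, hIT, -, hcl⟩
  · refine ⟨?_, fun ν hν => hs.IT_eq_none ν (by omega), ?_, hs.closed_mono, ?_⟩
    · intro τ hτ
      obtain ⟨σ, h1, h2, h3⟩ := hs.resolvedUpTo τ hτ
      exact ⟨σ, h1, by omega, h3⟩
    · intro ν hν hl hc
      rcases hl.lt_or_eq with hl | hl
      · exact hs.IT_ne_none ν hν (by omega) hc
      -- After stopping, all of level `r` is closed, hence so is level `r + 1`, and there is nothing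
      -- to check.
      · obtain ⟨h1, h2⟩ := hdrop ν hl
        exact absurd (hs.closed_mono _ (hst _ (hν.of_prefix h1) h2) _ h1) hc
    · intro ν hν
      obtain ⟨σ, h1, h2, h3⟩ := hs.resolved_of_closed ν hν
      exact ⟨σ, h1, by omega, h3⟩
  · have hle := detection_le_of_exhausts hdet
    have hnone : ∀ ν : List P, r + 1 < ν.length → det.IT ν = none := by
      intro ν hν
      rw [hle.none_iff]
      simp only [receive]
      rw [if_neg (by omega)]
      exact hs.IT_eq_none ν (by omega)
    have hold : ∀ ν : List P, ν.length ≤ r → s.IT ν ≠ none → det.IT ν ≠ none := by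
      intro ν hν hn
      rw [Ne, hle.none_iff]
      simp only [receive]
      rwa [if_neg (by omega)]
    have hup : ResolvedUpTo (r + 1) s.RT := by
      intro τ hτ
      obtain ⟨σ, h1, h2, h3⟩ := hs.resolvedUpTo τ hτ
      exact ⟨σ, h1, by omega, h3⟩
    refine ⟨resolvedUpTo_of_exhausts hnone hup hres, by rw [hIT]; exact hnone, ?_, ?_, ?_⟩
    · intro ν hν hl hc
      have hc' : ν ∉ s.closed := fun h => hc (by rw [hcl]; exact .inl (.inl h))
      rw [hIT]
      rcases hl.lt_or_eq with hl | hl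
      · exact hold ν (by omega) (hs.IT_ne_none ν hν (by omega) hc')
      · obtain ⟨h1, h2⟩ := hdrop ν hl
        -- The receive rule falls back on the value of the parent, so an open parent with a value
        -- suffices.
        have := hs.IT_ne_none _ (hν.of_prefix h1) h2.le
          fun h => hc' (hs.closed_mono _ h _ h1)
        rw [Ne, hle.none_iff]
        simp only [receive]
        rw [if_pos ⟨hν, hl, hc'⟩]
        split
        · simp_all
        · split_ifs
          · simp
          · simp [this]
    · intro ν hν τ hp
      rw [hcl] at hν ⊢
      rcases hν with (h | h) | ⟨σ, h1, h2⟩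
      · exact .inl (.inl (hs.closed_mono _ h _ hp))
      · exact .inl (.inr ⟨h.1, h.2.mono hp⟩)
      · exact .inr ⟨σ, h1.trans hp, h2⟩
    · intro ν hν
      rw [hcl] at hν
      rcases hν with (h | ⟨-, ρ, h1, h2⟩) | ⟨σ, h1, h2⟩
      · obtain ⟨σ, h1, h2, h3⟩ := hs.resolved_of_closed ν h
        exact ⟨σ, h1, by omega, ne_none_of_exhausts hres h3⟩
      · obtain ⟨σ, h3, h4, h5⟩ := hs.resolvedUpTo ρ h2
        exact ⟨σ, h3.trans h1, by omega, ne_none_of_exhausts hres h5⟩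
      · obtain ⟨τ, h3, h4, h5⟩ := hs.closed_of_early hres hold h2
        exact ⟨τ, h3.trans h1, h4, h5⟩

/-! ### Executions: fully corrupt nodes and the masking of their last processes. -/

namespace Execution

variable {S : Setting P D} (E : Execution S)

theorem inv {p : P} (hp : p ∈ S.G) : ∀ r ≤ S.φ + 1, (E.state r p).Inv S r
  | 0, _ => by
    refine ⟨fun ν hν => absurd (E.init_RT p hp ν) hν,
      fun ν hν => E.init_IT p hp ν (List.ne_nil_of_length_pos hν), ?_, ?_, ?_⟩
    · intro ν _ hl _
      obtain rfl : ν = [] := List.length_eq_zero_iff.1 (by omega)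
      simp [E.init_root p hp]
    · simp [E.init_closed p hp]
    · simp [E.init_closed p hp]
  | r + 1, hr => (inv hp r (by omega)).roundStep (E.step r (by omega) p hp)

theorem resolved_mono_succ {p : P} (hp : p ∈ S.G) {r : ℕ} (hr : r ≤ S.φ) {ν : List P}
    (h : Resolved (E.state r p).RT ν) : Resolved (E.state (r + 1) p).RT ν := by
  obtain ⟨σ, hσ, h⟩ := h
  refine ⟨σ, hσ, ?_⟩
  rcases E.step r hr p hp with ⟨-, hs⟩ | ⟨-, det, -, hres, -⟩
  · rw [hs]; exact h
  · exact ne_none_of_exhausts hres h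

theorem resolved_mono {p : P} (hp : p ∈ S.G) {r r' : ℕ} (hr : r ≤ r') (hr' : r' ≤ S.φ + 1)
    {ν : List P} (h : Resolved (E.state r p).RT ν) : Resolved (E.state r' p).RT ν := by
  induction r', hr using Nat.le_induction with
  | base => exact h
  | succ k hk ih => exact E.resolved_mono_succ hp (by omega) (ih (by omega))

theorem not_resolved {p : P} (hp : p ∈ S.G) {ν : List P} (hν : E.FullyCorrupt ν) {r : ℕ}
    (hr : r ≤ ν.length + 2) (hr' : r ≤ S.φ + 1) : ¬ Resolved (E.state r p).RT ν :=
  fun h => hν.2 p hp (E.resolved_mono hp (le_min hr hr') (min_le_right _ _) h)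

/-- The prefix is tested in an earlier round, but resolved nodes stay resolved and pass this on to
extensions. -/
theorem FullyCorrupt.of_prefix {E : Execution S} {ν τ : List P} (h : E.FullyCorrupt τ)
    (hp : ν <+: τ) : E.FullyCorrupt ν := by
  refine ⟨h.1.of_prefix hp, fun p hpG hres => h.2 p hpG ?_⟩
  have := hp.length_le
  exact (E.resolved_mono hpG (by omega) (min_le_right _ _) hres).mono hp

/-- A branch closed by round `r` has a resolved prefix of length at most `r - 1 ≤ |ν|`, and below
`ν` such a prefix would be one of `ν`. -/
theorem not_closed {p : P} (hp : p ∈ S.G) {ν τ : List P} (hν : E.FullyCorrupt ν) {r : ℕ}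
    (hr : r ≤ ν.length + 1) (hr' : r ≤ S.φ + 1) (hτ : ν <+: τ) :
    τ ∉ (E.state r p).closed := by
  intro h
  obtain ⟨σ, h1, h2, h3⟩ := (E.inv hp r hr').resolved_of_closed τ h
  exact E.not_resolved hp hν (by omega) hr'
    ⟨σ, List.prefix_of_prefix_length_le h1 hτ (by omega), h3⟩

theorem exists_notMem_of_length_lt {ν : List P} (h : ν.length < Fintype.card P) :
    ∃ v, v ∉ ν := by
  classical
  by_contra! hc
  have : (Finset.univ : Finset P) ⊆ ν.toFinset := fun v _ => by simpa using hc v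
  have := (Finset.card_le_card this).trans ν.toFinset_card_le
  rw [Finset.card_univ] at this
  omega

theorem isNode_append_singleton {ν : List P} (hν : S.IsNode ν) {v : P} (hv : v ∉ ν)
    (hl : ν.length ≤ S.t) : S.IsNode (ν ++ [v]) := by
  refine ⟨?_, by simpa using hl⟩
  rw [List.nodup_append]
  refine ⟨hν.1, by simp, ?_⟩
  rintro a ha b hb rfl
  simp_all

/-- A correct process does not stop while there is a fully corrupt node to wait for. -/
theorem not_stopped {p : P} (hp : p ∈ S.G) {ν : List P} (hν : E.FullyCorrupt ν) {r : ℕ}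
    (hr : r ≤ ν.length + 1) (hr' : r ≤ S.φ) : ¬ Stopped S r (E.state r p) := by
  intro h
  have hnc : ∀ τ ∈ (E.state r p).closed, τ.length = r → (τ <+: ν ∨ ν <+: τ) → False := by
    intro τ hτ hl hpre
    rcases hpre with hpre | hpre
    · exact E.not_closed hp (hν.of_prefix hpre) (by omega) (by omega) List.prefix_rfl hτ
    · exact E.not_closed hp hν hr (by omega) hpre hτ
  -- Level `r` contains an open node: a child of `ν` if `r = |ν| + 1`, otherwise a prefix of `ν`.
  rcases Nat.lt_or_ge ν.length r with hlt | hge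
  · have := S.φ_le_t
    have := S.three_t_lt
    obtain ⟨v, hv⟩ := exists_notMem_of_length_lt (ν := ν) (by omega)
    have hl : (ν ++ [v]).length = r := by simp; omega
    exact hnc _ (h _ (isNode_append_singleton hν.1 hv (by omega)) hl) hl
      (.inr (List.prefix_append _ _))
  · have hl : (ν.take r).length = r := by simp [hge]
    exact hnc _ (h _ (hν.1.of_prefix (List.take_prefix _ _)) hl) hl (.inl (List.take_prefix _ _))

theorem G_nonempty (S : Setting P D) : S.G.Nonempty := by
  have := S.card_G; have := S.three_t_lt
  exact Finset.card_pos.1 (by omega)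

/-- Resolve rules of a round in which `p` has not stopped, in terms of the state of `p`. -/
theorem exists_det {p : P} (hp : p ∈ S.G) {r : ℕ} (hr : r ≤ S.φ)
    (h : ¬ Stopped S r (E.state r p)) :
    ∃ det : Detection P D, ∃ F₀ : Set P, (E.state r p).F ⊆ F₀ ∧
      Exhausts (DetectStep S p (r + 1) (E.state r p).RT)
        ⟨F₀, receive S (r + 1) F₀ (fun q => E.msg (r + 1) q p) (E.state r p), ∅⟩ det ∧
      Exhausts (ResolveStep S (r + 1) det.F (E.state (r + 1) p).IT) (E.state r p).RT
        (E.state (r + 1) p).RT ∧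
      (E.state (r + 1) p).IT = det.IT ∧ det.F ⊆ (E.state (r + 1) p).F := by
  rcases E.step r hr p hp with ⟨hs, -⟩ | ⟨-, det, hdet, hres, hIT, hF, -⟩
  · exact absurd hs h
  · refine ⟨det, _, ?_, hdet, by rw [hIT]; exact hres, hIT, ?_⟩
    · exact fun x hx => .inl (.inl hx)
    · rw [hF]; exact Set.subset_union_left

theorem F_mono {p : P} (hp : p ∈ S.G) {r r' : ℕ} (hr : r ≤ r') (hr' : r' ≤ S.φ + 1) :
    (E.state r p).F ⊆ (E.state r' p).F := by
  induction r', hr using Nat.le_induction with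
  | base => rfl
  | succ k hk ih =>
    refine (ih (by omega)).trans ?_
    by_cases hs : Stopped S k (E.state k p)
    · rcases E.step k (by omega) p hp with ⟨-, h⟩ | ⟨h, -⟩
      · rw [h]; exact fun x hx => .inl (.inl hx)
      · exact absurd hs h
    · obtain ⟨det, F₀, h1, h2, -, -, h3⟩ := E.exists_det hp (by omega) hs
      exact h1.trans ((detection_le_of_exhausts h2).F_subset.trans h3)

theorem IT_bot_mono {p : P} (hp : p ∈ S.G) {r r' : ℕ} (hr : r ≤ r') (hr' : r' ≤ S.φ + 1)
    {ν : List P} (hν : ν.length ≤ r) (h : (E.state r p).IT ν = some S.bot) :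
    (E.state r' p).IT ν = some S.bot := by
  induction r', hr using Nat.le_induction with
  | base => exact h
  | succ k hk ih =>
    have ih := ih (by omega)
    by_cases hs : Stopped S k (E.state k p)
    · rcases E.step k (by omega) p hp with ⟨-, h⟩ | ⟨h, -⟩
      · rw [h]; exact ih
      · exact absurd hs h
    · obtain ⟨det, F₀, h1, h2, -, h4, -⟩ := E.exists_det hp (by omega) hs
      rw [h4]
      refine (detection_le_of_exhausts h2).eq_bot _ ?_
      simp only [receive]
      rwa [if_neg (by omega)]

/-- The last process of a fully corrupt node is detected two rounds later. -/
theorem masked_of_fullyCorrupt {p : P} (hp : p ∈ S.G) {σ : List P} {z : P}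
    (h : E.FullyCorrupt (σ ++ [z])) {r : ℕ} (hr : (σ ++ [z]).length + 2 ≤ r) (hr' : r ≤ S.φ + 1)
    {τ : List P} (hτ : (τ ++ [z]).length = r) (hc : E.FullyCorrupt (τ ++ [z])) :
    (E.state r p).IT (τ ++ [z]) = some S.bot := by
  obtain ⟨r, rfl⟩ : ∃ k, r = k + 1 := ⟨r - 1, by omega⟩
  have hns := E.not_stopped hp hc (r := r) (by omega) (by omega)
  obtain ⟨det, F₀, h1, h2, h3, h4, h5⟩ := E.exists_det hp (by omega) hns
  have hne : (E.state (r + 1) p).IT (τ ++ [z]) ≠ none :=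
    (E.inv hp (r + 1) hr').IT_ne_none _ hc.1 hτ.le
      (E.not_closed hp hc (by omega) hr' List.prefix_rfl)
  -- In round `|σz| + 2`, `n - t` voters would trigger IT-to-RT and resolve `σz`; without them Not
  -- IT-to-RT applies, so exhausted detection must contain `z`. The round is a parameter because it
  -- may be the current one or an earlier one.
  have hz : ∀ r det F₀, (σ ++ [z]).length + 2 = r + 1 → r ≤ S.φ →
      Exhausts (DetectStep S p (r + 1) (E.state r p).RT)
        ⟨F₀, receive S (r + 1) F₀ (fun q => E.msg (r + 1) q p) (E.state r p), ∅⟩ det →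
      Exhausts (ResolveStep S (r + 1) det.F (E.state (r + 1) p).IT) (E.state r p).RT
        (E.state (r + 1) p).RT → (E.state (r + 1) p).IT = det.IT → z ∈ det.F := by
    intro r det F₀ hr hr' h2 h3 h4
    by_contra hz
    refine h2.2 _ (.notItToRt σ z hz h.1 hr (E.not_resolved hp h (by omega) (by omega)) ?_)
    rintro ⟨d, hd⟩
    refine E.not_resolved hp h (r := r + 1) (by omega) (by omega)
      ⟨_, List.prefix_rfl, Resolves.ne_none_of_exhausts h3 h.1 (.itToRt _ d ?_)⟩
    rwa [h4]
  have hzF : z ∈ det.F := by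
    rcases hr.eq_or_lt with heq | hlt
    · exact hz r det F₀ heq (by omega) h2 h3 h4
    · have hns' := E.not_stopped hp h (r := (σ ++ [z]).length + 1) (by omega) (by omega)
      obtain ⟨det', F₀', -, h2', h3', h4', h5'⟩ := E.exists_det hp (by omega) hns'
      exact (detection_le_of_exhausts h2).F_subset (h1 (E.F_mono hp (by omega) (by omega)
        (h5' (hz _ det' F₀' (by omega) (by omega) h2' h3' h4'))))
  have hmasks : det.Masks S (r + 1) := h2.invariant _
    (masks_receive (fun ν hν => (E.inv hp r (by omega)).IT_eq_none ν (by omega)) ∅)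
    fun _ _ hxy hx => hx.detectStep hxy
  rw [h4] at hne ⊢
  exact hmasks z hzF _ hτ (by simp) hne

/-- If all correct processes hold `⊥` for a node, they also hold `⊥` for its correct children. -/
theorem IT_bot_child {p q : P} (hp : p ∈ S.G) (hq : q ∈ S.G) {ν : List P} (hr : ν.length ≤ S.φ)
    (hq' : q ∉ ν) (hν : S.IsNode ν) (hb : ∀ p ∈ S.G, (E.state ν.length p).IT ν = some S.bot)
    (hs : ¬ Stopped S ν.length (E.state ν.length p))
    (hc : ν ++ [q] ∉ (E.state ν.length p).closed) :
    (E.state (ν.length + 1) p).IT (ν ++ [q]) = some S.bot := by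
  have := S.φ_le_t
  obtain ⟨det, F₀, h1, h2, h3, h4, h5⟩ := E.exists_det hp hr hs
  rw [h4]
  refine (detection_le_of_exhausts h2).eq_bot _ ?_
  simp only [receive]
  rw [if_pos ⟨isNode_append_singleton hν hq' (by omega), by simp, hc⟩]
  simp only [List.getLast?_append, List.getLast?_singleton, Option.some_or,
    List.dropLast_concat]
  split_ifs
  · rfl
  -- A correct `q` sends `⊥` or is silent; in the latter case the receiver copies its own `⊥`.
  · rw [E.msg_correct _ q hq, sent]
    split_ifs
    · simp [hb q hq]
    · simp [hb p hp]

/-- The prefix of length `φ + 1` would be an open leaf, which the last-round rule resolves. -/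
theorem FullyCorrupt.length_le {E : Execution S} {ν : List P} (h : E.FullyCorrupt ν) :
    ν.length ≤ S.φ := by
  by_contra! hl
  obtain ⟨p, hp⟩ := G_nonempty S
  have hμ := h.of_prefix (List.take_prefix (S.φ + 1) ν)
  set μ := ν.take (S.φ + 1)
  have hμl : μ.length = S.φ + 1 := by simp [μ]; omega
  obtain ⟨det, F₀, -, -, h3, -, -⟩ := E.exists_det hp le_rfl (E.not_stopped hp hμ (by omega) le_rfl)
  obtain ⟨d, hd⟩ := Option.ne_none_iff_exists'.1 ((E.inv hp _ le_rfl).IT_ne_none _ hμ.1 hμl.le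
    (E.not_closed hp hμ (by omega) le_rfl List.prefix_rfl))
  exact E.not_resolved hp hμ (r := S.φ + 1) (by omega) le_rfl
    ⟨μ, List.prefix_rfl, Resolves.ne_none_of_exhausts h3 hμ.1 (.lastRound _ d hμl hd)⟩

/-- A process ending a fully corrupt node of length `i` ends no node of the corrupt tree of length
more than `i + 1`. -/
theorem length_le_of_fullyCorrupt {σ τ : List P} {z : P} (h : E.FullyCorrupt (σ ++ [z]))
    (hc : τ ++ [z] ∈ E.CT) : (τ ++ [z]).length ≤ (σ ++ [z]).length + 1 := by
  classical
  by_contra! hlt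
  obtain ⟨hc, hcor⟩ := hc
  have hφ := hc.length_le
  have htφ := S.φ_le_t
  have hmask := fun p (hp : p ∈ S.G) =>
    E.masked_of_fullyCorrupt hp h (r := (τ ++ [z]).length) (by omega) (by omega) rfl hc
  have hzG : ∀ q ∈ S.G, (τ ++ [z]).getLast? ≠ some q := by
    intro q hq
    simp only [List.getLast?_append, List.getLast?_singleton, Option.some_or, ne_eq,
      Option.some.injEq]
    rintro rfl
    exact hcor z (by simp) hq
  have hne : τ ++ [z] ≠ [] := by simp
  generalize τ ++ [z] = ν at *
  have hnot : ∀ q ∈ S.G, q ∉ ν := fun q hq hqν => hcor q hqν hq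
  have hchild : ∀ p ∈ S.G, ∀ v ∈ S.G,
      (E.state (ν.length + 1) p).IT (ν ++ [v]) = some S.bot := fun p hp v hv =>
    E.IT_bot_child hp hv hφ (hnot v hv) hc.1 hmask (E.not_stopped hp hc (by omega) hφ)
      (E.not_closed hp hc (by omega) (by omega) (List.prefix_append _ _))
  obtain ⟨p, hp⟩ := G_nonempty S
  have hcard := S.card_G
  obtain ⟨W, hWG, hW⟩ : ∃ W ⊆ S.G, W.card = Fintype.card P - S.t :=
    Finset.exists_subset_card_eq (by omega)
  -- If `|ν| < φ`, round `|ν| + 2` takes place, and the `⊥` of correct children and grandchildren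
  -- makes all of `W` voters. If `|ν| = φ`, the children are leaves and the relaxed rule replaces
  -- IT-to-RT.
  rcases hφ.lt_or_eq with hlt' | heq
  · have hgrand : ∀ v ∈ S.G, ∀ u ∈ S.G, u ≠ v →
        (E.state (ν.length + 2) p).IT (ν ++ [v, u]) = some S.bot := by
      intro v hv u hu huv
      have hlen : (ν ++ [v]).length = ν.length + 1 := by simp
      have := E.IT_bot_child (ν := ν ++ [v]) hp hu (by omega)
        (by simp [hnot u hu, huv]) (isNode_append_singleton hc.1 (hnot v hv) (by omega))
        (by rw [hlen]; exact fun p hp => hchild p hp v hv)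
        (by rw [hlen]; exact E.not_stopped hp hc (by omega) (by omega))
        (by
          rw [hlen, List.append_assoc]
          exact E.not_closed hp hc (by omega) (by omega) (List.prefix_append _ _))
      simpa [hlen] using this
    have hchild' : ∀ v ∈ S.G, (E.state (ν.length + 2) p).IT (ν ++ [v]) = some S.bot :=
      fun v hv => E.IT_bot_mono hp (Nat.le_succ _) (by omega) (by simp) (hchild p hp v hv)
    have hsup : ∀ u ∈ W, ∀ v ∈ W, Supporter (E.state (ν.length + 2) p).IT ν S.bot u v := by
      intro u hu v hv
      by_cases huv : u = v
      · exact .inr (.inl ⟨huv, hchild' v (hWG hv)⟩)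
      · exact .inr (.inr (.inl (hgrand v (hWG hv) u (hWG hu) huv)))
    obtain ⟨det, F₀, -, -, h3, -, -⟩ := E.exists_det hp (r := ν.length + 1) (by omega)
      (E.not_stopped hp hc le_rfl (by omega))
    refine E.not_resolved hp hc le_rfl (by omega) ⟨ν, List.prefix_rfl,
      Resolves.ne_none_of_exhausts h3 hc.1 (.itToRt _ S.bot ⟨W, hW, fun u hu => .inr
        ⟨hzG u (hWG hu), W, hW, fun v hv =>
          ⟨hsup u hu v hv, .inr ⟨W, hW, fun u' hu' => hsup u' hu' v hv⟩⟩⟩⟩)⟩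
  · obtain ⟨det, F₀, -, -, h3, -, -⟩ := E.exists_det hp le_rfl
      (E.not_stopped hp hc (r := S.φ) (by omega) le_rfl)
    have hinv := E.inv hp (S.φ + 1) le_rfl
    have hnr := E.not_resolved hp hc (r := S.φ + 1) (by omega) le_rfl
    have hall : ∀ v, S.IsNode (ν ++ [v]) → (E.state (S.φ + 1) p).RT (ν ++ [v]) ≠ none := by
      intro v hv
      have hlen : (ν ++ [v]).length = S.φ + 1 := by simp [heq]
      obtain ⟨d, hd⟩ := Option.ne_none_iff_exists'.1 (hinv.IT_ne_none _ hv hlen.le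
        (E.not_closed hp hc (by omega) le_rfl (List.prefix_append _ _)))
      exact Resolves.ne_none_of_exhausts h3 hv (.lastRound _ d hlen hd)
    obtain ⟨V, hVW, hV⟩ : ∃ V ⊆ W, V.card = Fintype.card P - S.t - 1 :=
      Finset.exists_subset_card_eq (by omega)
    refine hnr ⟨ν, List.prefix_rfl, Resolves.ne_none_of_exhausts h3 hc.1
      (.relaxed ν S.bot hne hall V hV fun v hv => ?_)⟩
    have hvG := hWG (hVW hv)
    have hlen : (ν ++ [v]).length = S.φ + 1 := by simp [heq]
    obtain ⟨d, hd⟩ := Option.ne_none_iff_exists'.1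
      (hall v (isNode_append_singleton hc.1 (hnot v hvG) (by omega)))
    -- A leaf value not taken from `IT` would come from a resolved prefix of `ν`, which full
    -- corruption excludes.
    rcases leaf_eq_some hinv.IT_eq_none (E.inv hp S.φ (by omega)).resolvedUpTo h3 hlen hd with
      h' | ⟨ρ, h1, h2, h3⟩
    · have := hchild p hp v hvG
      rw [heq, h'] at this
      rw [hd, this]
    · exact absurd ⟨ρ, List.prefix_of_prefix_length_le h1 (List.prefix_append _ _)
        (by omega), h3⟩ hnr

end Execution

/-! ### Counting -/

section Counting

variable {P : Type u}

/-- A prefix-closed family of repetition-free sequences in which the process at position `j`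
belongs to `A j` or to `A (j - 1)`. -/
structure Layered (T : Set (List P)) (A : ℕ → Set P) : Prop where
  nodup : ∀ ν ∈ T, ν.Nodup
  of_prefix : ∀ τ ∈ T, ∀ ν, ν <+: τ → ν ∈ T
  mem : ∀ ν z, ν ++ [z] ∈ T → z ∈ A (ν.length + 1) ∨ z ∈ A ν.length

/-- The members of `T` of length `k` that extend `σ`. -/
def extensions (T : Set (List P)) (σ : List P) (k : ℕ) : Set (List P) :=
  {ν | ν ∈ T ∧ σ <+: ν ∧ ν.length = k}

variable {T : Set (List P)} {A : ℕ → Set P}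

theorem Layered.exists_of_mem_extensions (h : Layered T A) {σ ν : List P} {k : ℕ}
    (hσ : σ.length ≤ k) (hν : ν ∈ extensions T σ (k + 1)) :
    ∃ μ ∈ extensions T σ k, ∃ z, (z ∈ A (k + 1) ∨ z ∈ A k) ∧ ν = μ ++ [z] := by
  obtain ⟨h1, h2, h3⟩ := hν
  rcases List.eq_nil_or_concat' ν with rfl | ⟨μ, z, rfl⟩
  · simp at h3
  · have hl : μ.length = k := by simpa using h3
    refine ⟨μ, ⟨h.of_prefix _ h1 _ (List.prefix_append _ _),
      List.prefix_of_prefix_length_le h2 (List.prefix_append _ _) (by omega), hl⟩, z, ?_, rfl⟩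
    rw [← hl]; exact h.mem μ z h1

variable [Finite P]

theorem finite_of_nodup {T : Set (List P)} (hT : ∀ ν ∈ T, ν.Nodup) : T.Finite := by
  have := Fintype.ofFinite P
  refine (List.finite_length_le P (Fintype.card P)).subset fun ν hν => ?_
  exact (hT ν hν).length_le_card

theorem ncard_le_mul {X Y : Set (List P)} {A : Set P} (hY : ∀ ν ∈ Y, ν.Nodup)
    (h : ∀ ν ∈ X, ∃ μ ∈ Y, ∃ z ∈ A, ν = μ ++ [z]) : X.ncard ≤ Y.ncard * A.ncard := by
  have hsub : X ⊆ (fun p : List P × P => p.1 ++ [p.2]) '' (Y ×ˢ A) := by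
    intro ν hν
    obtain ⟨μ, hμ, z, hz, rfl⟩ := h ν hν
    exact ⟨(μ, z), ⟨hμ, hz⟩, rfl⟩
  have hfin : (Y ×ˢ A).Finite := (finite_of_nodup hY).prod A.toFinite
  rw [← Set.ncard_prod]
  exact (Set.ncard_le_ncard hsub (hfin.image _)).trans (Set.ncard_image_le hfin)

theorem Layered.ncard_extensions_succ_le (h : Layered T A) {σ : List P} {k : ℕ}
    (hσ : σ.length ≤ k) : (extensions T σ (k + 1)).ncard ≤
      (extensions T σ k).ncard * ((A (k + 1)).ncard + (A k).ncard) := by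
  refine (ncard_le_mul (A := A (k + 1) ∪ A k) (fun ν hν => h.nodup ν hν.1) fun ν hν => ?_).trans
    (Nat.mul_le_mul_left _ (Set.ncard_union_le _ _))
  obtain ⟨μ, hμ, z, hz, rfl⟩ := h.exists_of_mem_extensions hσ hν
  exact ⟨μ, hμ, z, hz, rfl⟩

/-- While every layer has a single process, the number of extensions grows linearly: once a
sequence is in step with the layers it stays so. -/
theorem Layered.ncard_extensions_le (h : Layered T A) {σ : List P} {k m b : ℕ}
    (hσ : σ.length ≤ k) (hb : (extensions T σ (k + 1)).ncard ≤ b)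
    (hA : ∀ i, k < i → i < k + 1 + m → (A i).ncard = 1) (hA' : (A (k + 1 + m)).ncard ≤ 1) :
    (extensions T σ (k + 1 + m)).ncard ≤ b * (m + 1) ∧
      {ν ∈ extensions T σ (k + 1 + m) | ∀ z ∈ A (k + 1 + m), z ∉ ν.getLast?}.ncard ≤ b := by
  induction m with
  | zero =>
    refine ⟨by simpa using hb, (Set.ncard_le_ncard (Set.sep_subset _ _) ?_).trans hb⟩
    exact finite_of_nodup fun ν hν => h.nodup ν hν.1
  | succ m ih =>
    have h1 := hA (k + 1 + m) (by omega) (by omega)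
    obtain ⟨ih1, ih2⟩ := ih (fun i hi hi' => hA i hi (by omega)) h1.le
    set ℓ := k + 1 + m with hℓ
    have hℓ' : k + 1 + (m + 1) = ℓ + 1 := by omega
    rw [hℓ'] at hA' ⊢
    -- A lagging sequence ends in the only process of `A ℓ`. Its predecessor cannot end there too,
    -- so it lags as well and determines its extension.
    have hlag : {ν ∈ extensions T σ (ℓ + 1) | ∀ z ∈ A (ℓ + 1), z ∉ ν.getLast?}.ncard ≤ b := by
      refine (ncard_le_mul (A := A ℓ)
        (Y := {ν ∈ extensions T σ ℓ | ∀ z ∈ A ℓ, z ∉ ν.getLast?})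
        (fun ν hν => h.nodup ν hν.1.1) fun ν hν => ?_).trans (by simpa [h1] using ih2)
      obtain ⟨hν, hlast⟩ := hν
      obtain ⟨μ, hμ, z, hz, rfl⟩ := h.exists_of_mem_extensions (by omega) hν
      have hzA : z ∈ A ℓ := hz.resolve_left fun hz => hlast z hz (by simp)
      refine ⟨μ, ⟨hμ, fun z' hz' hz'μ => ?_⟩, z, hzA, rfl⟩
      obtain ⟨a, ha⟩ := Set.ncard_eq_one.1 h1
      rw [ha] at hzA hz'
      obtain rfl : z = z' := by rw [hzA, hz']
      have := h.nodup _ hν.1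
      rw [List.nodup_append] at this
      exact this.2.2 z (List.mem_of_getLast? hz'μ) z (by simp) rfl
    refine ⟨?_, hlag⟩
    -- A sequence in step has its last process prescribed, so it is determined by its predecessor.
    have hstep : {ν ∈ extensions T σ (ℓ + 1) | ∃ z ∈ A (ℓ + 1), z ∈ ν.getLast?}.ncard ≤
        b * (m + 1) := by
      refine (ncard_le_mul (A := A (ℓ + 1)) (Y := extensions T σ ℓ)
        (fun ν hν => h.nodup ν hν.1) fun ν hν => ?_).trans
        ((Nat.mul_le_mul ih1 hA').trans_eq (mul_one _))
      obtain ⟨hν, z', hz', hlast⟩ := hν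
      obtain ⟨μ, hμ, z, hz, rfl⟩ := h.exists_of_mem_extensions (by omega) hν
      obtain rfl : z = z' := by simpa using hlast
      exact ⟨μ, hμ, z, hz', rfl⟩
    have hunion : extensions T σ (ℓ + 1) ⊆
        {ν ∈ extensions T σ (ℓ + 1) | ∃ z ∈ A (ℓ + 1), z ∈ ν.getLast?} ∪
        {ν ∈ extensions T σ (ℓ + 1) | ∀ z ∈ A (ℓ + 1), z ∉ ν.getLast?} := by
      intro ν hν
      by_cases hc : ∃ z ∈ A (ℓ + 1), z ∈ ν.getLast?
      · exact .inl ⟨hν, hc⟩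
      · exact .inr ⟨hν, by push Not at hc; exact hc⟩
    have hfin : (extensions T σ (ℓ + 1)).Finite := finite_of_nodup fun ν hν => h.nodup ν hν.1
    have := (Set.ncard_le_ncard hunion ((hfin.subset (Set.sep_subset _ _)).union
      (hfin.subset (Set.sep_subset _ _)))).trans (Set.ncard_union_le _ _)
    nlinarith

end Counting

/-! ### Layers of the corrupt tree and the final count. -/

namespace Execution

variable {P : Type u} {D : Type v} [Fintype P] {S : Setting P D} (E : Execution S)

theorem exists_becomesFullyCorruptAt {τ : List P} {z : P} (h : E.FullyCorrupt (τ ++ [z])) :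
    ∃ i ≤ (τ ++ [z]).length, E.BecomesFullyCorruptAt z i := by
  classical
  have hex : ∃ i, ∃ σ : List P, (σ ++ [z]).length = i ∧ E.FullyCorrupt (σ ++ [z]) :=
    ⟨_, τ, rfl, h⟩
  exact ⟨Nat.find hex, Nat.find_min' hex ⟨τ, rfl, h⟩, Nat.find_spec hex,
    fun σ hσ hc => Nat.find_min hex hσ ⟨σ, rfl, hc⟩⟩

/-- For membership, apply `length_le_of_fullyCorrupt` to a node witnessing when the last process
first became fully corrupt. -/
theorem layered_CT : Layered E.CT fun i => {z | E.BecomesFullyCorruptAt z i} where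
  nodup ν hν := hν.1.1.1
  of_prefix τ hτ ν hp := ⟨hτ.1.of_prefix hp, fun z hz => hτ.2 z (hp.subset hz)⟩
  mem ν z hν := by
    obtain ⟨i, hi, hz⟩ := E.exists_becomesFullyCorruptAt hν.1
    obtain ⟨σ, hσ, hc⟩ := hz.1
    have := E.length_le_of_fullyCorrupt hc hν
    have hl : (ν ++ [z]).length = ν.length + 1 := by simp
    obtain rfl | rfl : i = ν.length + 1 ∨ i = ν.length := by omega
    · exact .inl hz
    · exact .inr hz

/-- If there is a node of length `i` in the corrupt tree then at least `i` processes become fully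
corrupt at `i` or before. -/
theorem length_le_sum_α {ν : List P} (hν : ν ∈ E.CT) :
    ν.length ≤ ∑ j ∈ Finset.range (ν.length + 1), E.α j := by
  classical
  let A : ℕ → Finset P := fun i => {z | E.BecomesFullyCorruptAt z i}
  have hA : ∀ i, E.α i = (A i).card := by
    intro i
    rw [α, ← Set.ncard_coe_finset]
    simp [A]
  -- Each process of `ν` ends a prefix of `ν`, which is fully corrupt; the processes are distinct.
  have hsub : ν.toFinset ⊆ (Finset.range (ν.length + 1)).biUnion A := by
    intro z hz
    obtain ⟨s, t, rfl⟩ := List.append_of_mem (List.mem_toFinset.1 hz)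
    obtain ⟨i, hi, hz⟩ := E.exists_becomesFullyCorruptAt
      (hν.1.of_prefix (ν := s ++ [z]) ⟨t, by simp⟩)
    simp only [Finset.mem_biUnion, Finset.mem_range]
    refine ⟨i, ?_, by simpa [A] using hz⟩
    simp at hi ⊢; omega
  have := (Finset.card_le_card hsub).trans Finset.card_biUnion_le
  rw [List.toFinset_card_of_nodup hν.1.1.1] at this
  simpa only [hA] using this

theorem α_zero : E.α 0 = 0 := by
  have : {z | E.BecomesFullyCorruptAt z 0} = ∅ := by
    ext z
    simp [BecomesFullyCorruptAt]
  rw [α, this, Set.ncard_empty]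

end Execution
end EIG

open EIG in
theorem mainTheorem8 :
    ∃ C : ℕ, ∀ (P : Type u) (D : Type v) [Fintype P] (S : EIG.Setting P D) (E : EIG.Execution S)
      (i₁ i₂ : ℕ), i₁ < i₂ → 2 < E.α i₁ → E.α (i₁ - 1) + E.α i₁ < 6 →
      (E.α i₂ = 0 ∨ E.α i₂ = 1) → (∀ i, i₁ < i → i < i₂ → E.α i = 1) →
      E.waste (i₂ + 1) < 6 →
      ∀ σ ∈ E.CT, σ.length = i₁ - 1 →
        {ν | ν ∈ E.CT ∧ σ <+: ν ∧ ν.length = i₂ + 1}.ncard ≤ C * (i₂ - i₁) ∧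
        {ν | ν ∈ E.CT ∧ σ <+: ν ∧ ν.length ≤ i₂ + 1}.ncard ≤ C * (i₂ - i₁) ^ 2 := by
  -- `840 = 4 · 210`: there are `m + 4 ≤ 4(m + 1)` levels, each with at most `210(m + 1)` nodes,
  -- where `m + 1 = i₂ - i₁`.
  refine ⟨840, ?_⟩
  intro P D _ S E i₁ i₂ hi h2 h6 hi₂ hmid hwaste σ hσ hlen
  have hL := E.layered_CT
  have hα : ∀ i, Set.ncard {z | E.BecomesFullyCorruptAt z i} = E.α i := fun _ => rfl
  -- `α 0 = 0` excludes `i₁ = 0`, so the subtraction in `i₁ - 1` is genuine.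
  obtain ⟨k, rfl⟩ : ∃ k, i₁ = k + 1 := ⟨i₁ - 1, by
    rcases i₁ with _ | n
    · simp [E.α_zero] at h2
    · omega⟩
  obtain ⟨m, rfl⟩ : ∃ m, i₂ = k + 1 + 1 + m := ⟨i₂ - (k + 2), by omega⟩
  rw [Nat.add_sub_cancel] at h6 hlen
  rw [show k + 1 + 1 + m - (k + 1) = m + 1 by omega]
  have hT0 : (extensions E.CT σ k).ncard ≤ 1 := by
    refine (Set.ncard_le_one (finite_of_nodup fun ν hν => hL.nodup ν hν.1)).2 fun a ha b hb => ?_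
    rw [← ha.2.1.eq_of_length (by rw [ha.2.2, hlen]), hb.2.1.eq_of_length (by rw [hb.2.2, hlen])]
  have hT1 : (extensions E.CT σ (k + 1)).ncard ≤ 5 := by
    have := hL.ncard_extensions_succ_le hlen.le
    simp only [hα] at this
    nlinarith
  have hα2 : E.α (k + 1 + 1) ≤ 1 := by
    rcases Nat.eq_zero_or_pos m with rfl | hm
    · rcases hi₂ with h | h <;> simp_all
    · exact (hmid _ (by omega) (by omega)).le
  have hT2 : (extensions E.CT σ (k + 1 + 1)).ncard ≤ 30 := by
    have := hL.ncard_extensions_succ_le (k := k + 1) (by omega : σ.length ≤ k + 1)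
    simp only [hα] at this
    calc _ ≤ _ := this
      _ ≤ 5 * 6 := Nat.mul_le_mul hT1 (by omega)
  have hTmid : ∀ j ≤ m, (extensions E.CT σ (k + 1 + 1 + j)).ncard ≤ 30 * (m + 1) := by
    intro j hj
    refine (hL.ncard_extensions_le (k := k + 1) (m := j) (by omega) hT2 ?_ ?_).1.trans
      (Nat.mul_le_mul_left _ (by omega))
    · exact fun i h1 h2 => hmid i h1 (by omega)
    · rw [hα]
      rcases hj.lt_or_eq with hj | rfl
      · exact (hmid _ (by omega) (by omega)).le
      · omega
  have hTlast : (extensions E.CT σ (k + 1 + 1 + m + 1)).ncard ≤ 210 * (m + 1) := by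
    -- The bound on the last `α` needs a node of length `i₂`, so the empty case is split off.
    rcases (extensions E.CT σ (k + 1 + 1 + m + 1)).eq_empty_or_nonempty with he | ⟨ν, hν⟩
    · simp [he]
    have hstep := hL.ncard_extensions_succ_le (by omega : σ.length ≤ k + 1 + 1 + m)
    simp only [hα] at hstep
    -- A node of length `i₂` gives `∑_{j ≤ i₂} α_j ≥ i₂`, while the waste bound gives `∑_{j ≤ i₂ +
    -- 1} α_j < i₂ + 7`.
    have hlast : E.α (k + 1 + 1 + m + 1) ≤ 6 := by
      obtain ⟨μ, hμ, -⟩ := hL.exists_of_mem_extensions (by omega) hν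
      have hsum := E.length_le_sum_α hμ.1
      rw [hμ.2.2] at hsum
      rw [Execution.waste, Finset.sum_range_succ] at hwaste
      push_cast at hwaste
      zify at hsum ⊢
      linarith
    calc _ ≤ _ := hstep
      -- `7` is `6` for `α` at `i₂ + 1` plus `1` for `α` at `i₂`.
      _ ≤ (30 * (m + 1)) * 7 := Nat.mul_le_mul (hTmid m le_rfl) (by omega)
      _ = _ := by ring
  refine ⟨hTlast.trans (Nat.mul_le_mul_right _ (by norm_num)), ?_⟩
  have hTall : ∀ j ∈ Finset.range (m + 4), (extensions E.CT σ (k + j)).ncard ≤ 210 * (m + 1) := by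
    intro j hj
    rw [Finset.mem_range] at hj
    obtain rfl | rfl | rfl | ⟨i, hi, rfl⟩ :
        j = 0 ∨ j = 1 ∨ j = m + 3 ∨ ∃ i ≤ m, j = i + 2 := by
      by_cases h : 2 ≤ j ∧ j ≤ m + 2
      · exact .inr (.inr (.inr ⟨j - 2, by omega, by omega⟩))
      · omega
    · rw [add_zero]; omega
    · omega
    · rwa [show k + (m + 3) = k + 1 + 1 + m + 1 by omega]
    · rw [show k + (i + 2) = k + 1 + 1 + i by omega]
      have := hTmid i hi
      omega
  have hsub : {ν | ν ∈ E.CT ∧ σ <+: ν ∧ ν.length ≤ k + 1 + 1 + m + 1} ⊆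
      ⋃ j ∈ Finset.range (m + 4), extensions E.CT σ (k + j) := by
    rintro ν ⟨h1, h2, h3⟩
    have := h2.length_le
    simp only [Set.mem_iUnion, Finset.mem_range]
    exact ⟨ν.length - k, by omega, h1, h2, by omega⟩
  have hfin : (⋃ j ∈ Finset.range (m + 4), extensions E.CT σ (k + j)).Finite :=
    finite_of_nodup fun ν hν => by
      simp only [Set.mem_iUnion] at hν
      obtain ⟨j, -, hν⟩ := hν
      exact hL.nodup ν hν.1
  calc _ ≤ _ := Set.ncard_le_ncard hsub hfin
    _ ≤ ∑ j ∈ Finset.range (m + 4), (extensions E.CT σ (k + j)).ncard :=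
      Finset.set_ncard_biUnion_le _ _
    _ ≤ ∑ j ∈ Finset.range (m + 4), 210 * (m + 1) := Finset.sum_le_sum hTall
    _ = (m + 4) * (210 * (m + 1)) := by simp
    _ ≤ 840 * (m + 1) ^ 2 := by nlinarith
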